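/- Let $X$ be a metric graph, i.e. a metric space which is geodesic (any two points $x,y\in X$ are joined by an isometric embedding $[0,d(x,y)]\to X$ with $0\mapsto x$, $d(x,y)\mapsto y$) and homeomorphic to a finite $1$-dimensional simplicial complex. Let $\alpha$ be a shortest non-contractible loop in $X$, i.e. a non-contractible (not null-homotopic) closed path whose length is at most the length of every non-contractible closed path in $X$ (with any base point). Then there exists a contraction from $X$ to the image $\alpha\subset X$ of the loop, i.e. a $1$-Lipschitz retraction: a map $f\colon X\to\alpha$ with $f(a)=a$ for all $a\in\alpha$ and $d(f(x),f(y))\le d(x,y)$ for all $x,y\in X$. -/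

import Mathlib

/-- A metric space is geodesic if any two points `x`, `y` are joined by an isometric embedding of
the real interval `[0, d(x, y)]`. -/
def IsGeodesicSpace (X : Type*) [MetricSpace X] : Prop :=
  ∀ x y : X, ∃ c : Set.Icc (0 : ℝ) (dist x y) → X,
    Isometry c ∧ c ⟨0, le_rfl, dist_nonneg⟩ = x ∧ c ⟨dist x y, dist_nonneg, le_rfl⟩ = y

/-- A geometric simplicial complex is finite and `1`-dimensional if it has finitely many faces,
each of them a vertex or an edge, and at least one of them an edge. -/
def Geometry.SimplicialComplex.IsFiniteOneDimensional {E : Type*} [AddCommGroup E] [Module ℝ E]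
    (K : Geometry.SimplicialComplex ℝ E) : Prop :=
  K.faces.Finite ∧ (∀ s ∈ K.faces, s.card ≤ 2) ∧ ∃ s ∈ K.faces, s.card = 2

/-- A metric graph is a geodesic space homeomorphic to (the underlying space of) a finite
`1`-dimensional simplicial complex. Every finite simplicial complex is realized in
some Euclidean space. -/
def IsMetricGraph (X : Type*) [MetricSpace X] : Prop :=
  IsGeodesicSpace X ∧
    ∃ (n : ℕ) (K : Geometry.SimplicialComplex ℝ (EuclideanSpace ℝ (Fin n))),
      K.IsFiniteOneDimensional ∧ Nonempty (X ≃ₜ K.space)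

/-- The length of a path: the supremum of the lengths of inscribed polygonal chains (possibly
infinite). -/
noncomputable def Path.metricLength {X : Type*} [MetricSpace X] {x y : X} (γ : Path x y) :
    ENNReal :=
  eVariationOn γ Set.univ

/-- A loop is contractible if it is homotopic, relative to its base point, to the constant loop. -/
def Path.IsContractibleLoop {X : Type*} [TopologicalSpace X] {x : X} (γ : Path x x) : Prop :=
  γ.Homotopic (Path.refl x)

/-- A shortest non-contractible loop: a non-contractible loop whose length is minimal among all
non-contractible loops of the space, based at arbitrary points. -/
def Path.IsShortestNoncontractibleLoop {X : Type*} [MetricSpace X] {x : X} (γ : Path x x) : Prop :=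
  ¬ γ.IsContractibleLoop ∧
    ∀ (y : X) (δ : Path y y), ¬ δ.IsContractibleLoop → γ.metricLength ≤ δ.metricLength

/-- A retraction of a space to a closed subspace `A`. -/
def IsRetractionTo {X : Type*} [TopologicalSpace X] (A : Set X) (f : X → A) : Prop :=
  IsClosed A ∧ Continuous f ∧ ∀ a : A, f a = a

/-- An `r`-contraction of `X` to `A`. -/
def IsRContraction {X : Type*} [MetricSpace X] (A : Set X) (r : ℝ) (f : X → A) : Prop :=
  IsRetractionTo A f ∧ ∀ x y : X, dist x y < r → dist (f x) (f y) < r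

/-- A contraction of `X` to `A`: an `r`-contraction for each `r > 0`. -/
def IsContraction {X : Type*} [MetricSpace X] (A : Set X) (f : X → A) : Prop :=
  ∀ r : ℝ, 0 < r → IsRContraction A r f

/-- Contractions are exactly the `1`-Lipschitz retractions. -/
theorem isContraction_iff {X : Type*} [MetricSpace X] (A : Set X) (f : X → A) :
    IsContraction A f ↔ IsRetractionTo A f ∧ LipschitzWith 1 f := by
  constructor
  · intro h
    refine ⟨(h 1 one_pos).1, LipschitzWith.of_dist_le_mul fun x y => ?_⟩
    rw [NNReal.coe_one, one_mul]
    exact le_of_forall_gt fun r hr => (h r (dist_nonneg.trans_lt hr)).2 x y hr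
  · rintro ⟨h, hl⟩ r -
    refine ⟨h, fun x y hxy => ?_⟩
    have := hl.dist_le_mul x y
    rw [NNReal.coe_one, one_mul] at this
    exact this.trans_lt hxy

/-! Let `p` be the length of the loop. If two of its points were joined by a geodesic shorter than
both arcs between them, replacing one arc would give a shorter non-contractible loop. Hence the
image of the loop is an isometrically embedded circle of length `p` (`exists_isometry`), and `p` is
positive and finite.

Choose a point on this circle that is not a vertex of the graph, parametrize the circle by arc
length `G` with `G 0` at that point, and put `r = p / 2`. Paths in the open ball of radius `r` about
`G 0` with common endpoints are homotopic in `X`, since thin triangles with apex `G 0` have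
perimeter below `p` (`homotopic_of_edist_lt`). Therefore `G 0` separates the two half-circles inside
the ball (`not_joinedIn_ball_diff_center`): a detour around it would be homotopic to the arc through
it, and collapsing all but the open edge through `G 0` to a point maps `X` to a circle where lifts
tell the two apart.

The retraction keeps the distance to `G 0`, truncated at `r`, and picks the half-circle by the side
of `G 0`. A geodesic between points sent to different halves passes through `G 0` or leaves the
ball; the two halves meet at `G 0` and at `G r = G (-r)`, so distances do not grow. -/

open Set
open scoped unitInterval Topology ENNReal

/-! ### Lengths of paths and geodesics -/

namespace Path

variable {X : Type*} [MetricSpace X]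

theorem metricLength_trans_le {x y z : X} (γ : Path x y) (δ : Path y z) :
    (γ.trans δ).metricLength ≤ γ.metricLength + δ.metricLength := by
  have h01 : (univ : Set I) = univ ∩ Icc 0 1 := by
    ext t; simpa using unitInterval.le_one'
  let h : I := ⟨1 / 2, by norm_num, by norm_num⟩
  have h0 : (0 : I) ≤ h := h.2.1
  have h1 : h ≤ 1 := h.2.2
  unfold metricLength
  rw [h01, ← eVariationOn.Icc_add_Icc _ h0 h1 (mem_univ _)]
  refine add_le_add ?_ ?_
  · rw [← h01]
    have : EqOn (γ.trans δ) (γ ∘ fun t : I => projIcc 0 1 zero_le_one (2 * (t : ℝ)))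
        (univ ∩ Icc 0 h) := by
      rintro t ⟨-, -, ht⟩
      have ht' : (t : ℝ) ≤ 1 / 2 := ht
      simp only [Function.comp, trans, coe_mk_mk, extend, ContinuousMap.coe_mk, if_pos ht']
      rfl
    rw [eVariationOn.congr this]
    refine eVariationOn.comp_le_of_monotoneOn _ _ (fun a _ b _ hab => ?_) (mapsTo_univ _ _)
    refine monotone_projIcc _ ?_
    have : (a : ℝ) ≤ b := hab
    linarith
  · rw [← h01]
    have : EqOn (γ.trans δ) (δ ∘ fun t : I => projIcc 0 1 zero_le_one (2 * (t : ℝ) - 1))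
        (univ ∩ Icc h 1) := by
      rintro t ⟨-, ht, -⟩
      have ht' : 1 / 2 ≤ (t : ℝ) := ht
      have := extend_trans_of_half_le γ δ ht'
      rw [extend_extends'] at this
      rw [this]
      rfl
    rw [eVariationOn.congr this]
    refine eVariationOn.comp_le_of_monotoneOn _ _ (fun a _ b _ hab => ?_) (mapsTo_univ _ _)
    refine monotone_projIcc _ ?_
    have : (a : ℝ) ≤ b := hab
    linarith

theorem metricLength_symm_le {x y : X} (γ : Path x y) :
    γ.symm.metricLength ≤ γ.metricLength :=
  eVariationOn.comp_le_of_antitoneOn _ _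
    (fun _ _ _ _ hab => unitInterval.symm_le_symm.2 hab) (mapsTo_univ _ _)

theorem metricLength_subpath_le {x y : X} (γ : Path x y) {s t : I} (hst : s ≤ t) :
    (γ.subpath s t).metricLength ≤ eVariationOn γ (Icc s t) := by
  refine eVariationOn.comp_le_of_monotoneOn _ _ (fun a _ b _ hab => ?_) fun u _ => ?_
  · have h1 : (a : ℝ) ≤ b := hab
    have h2 : (s : ℝ) ≤ t := hst
    rw [← Subtype.coe_le_coe]
    simp only [Set.Icc.coe_convexComb]
    nlinarith
  · have := mem_range_self (f := Icc.convexComb s t) u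
    rwa [range_subpathAux, uIcc_of_le hst] at this

theorem metricLength_le_of_lipschitz {x y : X} (γ : Path x y) {K : NNReal}
    (h : LipschitzWith K γ) : γ.metricLength ≤ K := by
  have key : eVariationOn (γ ∘ fun t : I => t) univ ≤ K * eVariationOn (fun t : I => t) univ :=
    (h.lipschitzOnWith (s := univ)).comp_eVariationOn_le (mapsTo_univ _ _)
  refine key.trans ?_
  have h1 : eVariationOn (fun t : I => (t : ℝ)) univ ≤ 1 := by
    have h01 : (univ : Set I) = univ ∩ Icc 0 1 := by
      ext t; simpa using unitInterval.le_one'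
    have hm : MonotoneOn (fun t : I => (t : ℝ)) univ := fun _ _ _ _ hab => hab
    rw [h01, hm.eVariationOn_eq (mem_univ 0) (mem_univ 1)]
    simp
  calc _ ≤ (K : ℝ≥0∞) * 1 := mul_le_mul_right h1 _
    _ = K := mul_one _

end Path

namespace IsGeodesicSpace

variable {X : Type*} [MetricSpace X]

theorem exists_path_dist_eq (h : IsGeodesicSpace X) (x y : X) :
    ∃ γ : Path x y, ∀ s t, dist (γ s) (γ t) = |(s : ℝ) - t| * dist x y := by
  obtain ⟨c, hc, h0, h1⟩ := h x y
  have hm : ∀ t : I, (t : ℝ) * dist x y ∈ Icc 0 (dist x y) := fun t =>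
    ⟨mul_nonneg t.2.1 dist_nonneg, mul_le_of_le_one_left dist_nonneg t.2.2⟩
  exact ⟨{  toFun := fun t => c ⟨t * dist x y, hm t⟩
            continuous_toFun := hc.continuous.comp (by fun_prop)
            source' := by simpa using h0
            target' := by simpa using h1 }, fun s t => by
    change dist (c _) (c _) = _
    rw [hc.dist_eq, Subtype.dist_eq, Real.dist_eq, ← sub_mul, abs_mul, abs_of_nonneg dist_nonneg]⟩

theorem exists_path (h : IsGeodesicSpace X) (x y : X) :
    ∃ γ : Path x y, γ.metricLength ≤ edist x y ∧
      ∀ t, dist x (γ t) + dist (γ t) y = dist x y := by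
  obtain ⟨γ, hγ⟩ := h.exists_path_dist_eq x y
  refine ⟨γ, ?_, fun t => ?_⟩
  · rw [edist_nndist]
    refine γ.metricLength_le_of_lipschitz (LipschitzWith.of_dist_le_mul fun s t => ?_)
    rw [hγ, mul_comm, coe_nndist]
    rfl
  · have e0 := hγ 0 t
    have e1 := hγ t 1
    rw [γ.source] at e0
    rw [γ.target] at e1
    rw [e0, e1, ← add_mul, abs_of_nonpos (by simp [t.2.1]), abs_of_nonpos (by simp [t.2.2])]
    simp

end IsGeodesicSpace

/-! ### Homotopies from short loops and simply connected sets -/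

namespace Path

variable {X : Type*}

theorem Homotopic.of_trans_symm [TopologicalSpace X] {x y : X} {γ δ : Path x y}
    (h : (γ.trans δ.symm).Homotopic (Path.refl x)) : γ.Homotopic δ := by
  rw [← Homotopic.Quotient.eq] at h ⊢
  have := congrArg (fun q => q.trans (Homotopic.Quotient.mk δ)) h
  simpa [Homotopic.Quotient.mk_trans, Homotopic.Quotient.mk_symm] using this

variable [MetricSpace X]

theorem homotopic_of_metricLength_add_lt {L : ℝ≥0∞}
    (hL : ∀ (y : X) (δ : Path y y), δ.metricLength < L → δ.IsContractibleLoop)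
    {x y : X} (γ δ : Path x y) (h : γ.metricLength + δ.metricLength < L) : γ.Homotopic δ :=
  .of_trans_symm <| hL _ _ <| ((metricLength_trans_le _ _).trans
    (add_le_add_right (metricLength_symm_le δ) _)).trans_lt h

end Path

theorem IsSimplyConnected.homotopic {X : Type*} [TopologicalSpace X] {s : Set X}
    (hs : IsSimplyConnected s) {x y : X} {γ δ : Path x y} (hγ : ∀ t, γ t ∈ s)
    (hδ : ∀ t, δ t ∈ s) : γ.Homotopic δ := by
  refine .of_trans_symm ?_
  obtain ⟨F, -⟩ := (isSimplyConnected_iff_exists_homotopy_refl_forall_mem.1 hs).2 x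
    (γ.trans δ.symm) fun t => by
      have h : γ.trans δ.symm t ∈ range (γ.trans δ.symm) := mem_range_self t
      rw [Path.trans_range, Path.symm_range] at h
      rcases h with ⟨u, hu⟩ | ⟨u, hu⟩
      · exact hu ▸ hγ u
      · exact hu ▸ hδ u
  exact ⟨F⟩

/-! ### Uniform local simple connectivity of a graph -/

namespace Geometry.SimplicialComplex

variable {E : Type*} [NormedAddCommGroup E] [NormedSpace ℝ E] {K : SimplicialComplex ℝ E}

theorem isClosed_biUnion_convexHull {F : Set (Finset E)} (hF : F.Finite) :
    IsClosed (⋃ s ∈ F, convexHull ℝ (s : Set E)) :=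
  hF.isClosed_biUnion fun s _ => s.finite_toSet.isClosed_convexHull ℝ

theorem isCompact_space (hK : K.faces.Finite) : IsCompact K.space :=
  hK.isCompact_biUnion fun s _ => s.finite_toSet.isCompact_convexHull ℝ

/-- A small ball misses the finitely many closed faces that avoid `p`; the others are convex and
contain `p`. -/
theorem exists_starConvex_inter_ball (hK : K.faces.Finite) (p : E) :
    ∃ ε > 0, StarConvex ℝ p (K.space ∩ Metric.ball p ε) := by
  have hC := isClosed_biUnion_convexHull
    (hK.subset (sep_subset K.faces fun s => p ∉ convexHull ℝ (s : Set E)))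
  obtain ⟨ε, hε, hball⟩ := Metric.isOpen_iff.1 hC.isOpen_compl p (by simp)
  refine ⟨ε, hε, fun y ⟨hy, hyε⟩ a b ha hb hab => ⟨?_, ?_⟩⟩
  · obtain ⟨s, hs, hys⟩ := mem_space_iff.1 hy
    have hps : p ∈ convexHull ℝ (s : Set E) := by
      by_contra h
      exact hball hyε (mem_biUnion (show s ∈ {s ∈ K.faces | p ∉ convexHull ℝ (s : Set E)} from
        ⟨hs, h⟩) hys)
    exact convexHull_subset_space hs ((convex_convexHull ℝ _).starConvex hps hys ha hb hab)
  · exact (convex_ball p ε).starConvex (Metric.mem_ball_self hε) hyε ha hb hab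

theorem exists_isSimplyConnected_inter_ball (hK : K.faces.Finite) {p : E} (hp : p ∈ K.space) :
    ∃ ε > 0, IsSimplyConnected (K.space ∩ Metric.ball p ε) := by
  obtain ⟨ε, hε, h⟩ := exists_starConvex_inter_ball hK p
  have := h.contractibleSpace ⟨p, hp, Metric.mem_ball_self hε⟩
  exact ⟨ε, hε, show SimplyConnectedSpace _ from inferInstance⟩

end Geometry.SimplicialComplex

namespace IsMetricGraph

variable {X : Type*} [MetricSpace X]

theorem compactSpace (hX : IsMetricGraph X) : CompactSpace X := by
  obtain ⟨-, n, K, hK, ⟨e⟩⟩ := hX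
  have := isCompact_iff_compactSpace.1 (K.isCompact_space hK.1)
  exact e.symm.compactSpace

/-- A Lebesgue number for a cover by simply connected open sets makes the radius uniform. -/
theorem exists_ball_homotopic (hX : IsMetricGraph X) :
    ∃ ε > 0, ∀ (z x y : X) (γ δ : Path x y), (∀ t, γ t ∈ Metric.ball z ε) →
      (∀ t, δ t ∈ Metric.ball z ε) → γ.Homotopic δ := by
  have := hX.compactSpace
  obtain ⟨-, n, K, hK, ⟨e⟩⟩ := hX
  choose r hr hsc using fun x : X => K.exists_isSimplyConnected_inter_ball hK.1 (e x).2
  have hU : ∀ x : X, IsSimplyConnected (e ⁻¹' (Subtype.val ⁻¹' Metric.ball (e x : _) (r x))) := by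
    intro x
    rw [e.isSimplyConnected_preimage, ← Topology.IsEmbedding.subtypeVal.isSimplyConnected_image,
      Subtype.image_preimage_coe]
    exact hsc x
  obtain ⟨ε, hε, h⟩ := lebesgue_number_lemma_of_metric (isCompact_univ (X := X))
    (c := fun x => e ⁻¹' (Subtype.val ⁻¹' Metric.ball (e x : _) (r x)))
    (fun x => (Metric.isOpen_ball.preimage continuous_subtype_val).preimage e.continuous)
    fun x _ => mem_iUnion.2 ⟨x, Metric.mem_ball_self (hr x)⟩
  refine ⟨ε, hε, fun z x y γ δ hγ hδ => ?_⟩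
  obtain ⟨i, hi⟩ := h z trivial
  exact (hU i).homotopic (fun t => hi (hγ t)) fun t => hi (hδ t)

end IsMetricGraph

/-! ### Collapsing a graph onto the circle made from one edge -/

namespace Geometry.SimplicialComplex

variable {E : Type*} [NormedAddCommGroup E] [InnerProductSpace ℝ E] {K : SimplicialComplex ℝ E}

theorem exists_edge_of_notMem_vertices (hK : ∀ s ∈ K.faces, s.card ≤ 2) {p : E}
    (hp : p ∈ K.space) (hpv : p ∉ K.vertices) :
    ∃ v w, v ≠ w ∧ (∃ s ∈ K.faces, (s : Set E) = {v, w}) ∧ p ∈ segment ℝ v w ∧ p ≠ v ∧ p ≠ w := by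
  obtain ⟨s, hs, hps⟩ := mem_space_iff.1 hp
  have hv : ∀ u ∈ s, u ∈ K.vertices := fun u hu =>
    K.down_closed hs (Finset.singleton_subset_iff.2 hu) (Finset.singleton_nonempty u)
  have h0 := (K.nonempty_of_mem_faces hs).card_pos
  have h2 := hK s hs
  obtain h | h : s.card = 1 ∨ s.card = 2 := by omega
  · obtain ⟨v, rfl⟩ := Finset.card_eq_one.1 h
    rw [Finset.coe_singleton, convexHull_singleton] at hps
    exact absurd (hps ▸ hv v (by simp)) hpv
  · classical
    obtain ⟨v, w, hvw, rfl⟩ := Finset.card_eq_two.1 h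
    refine ⟨v, w, hvw, ⟨_, hs, by simp⟩, ?_, ?_, ?_⟩
    · rwa [Finset.coe_pair, convexHull_pair] at hps
    · rintro rfl
      exact hpv (hv p (by simp))
    · rintro rfl
      exact hpv (hv p (by simp))

/-- Faces meet in the hull of their common vertices, and another face of at most two vertices shares
at most one with the edge `s`. -/
theorem inter_segment_subset (hK : ∀ s ∈ K.faces, s.card ≤ 2) {s t : Finset E} {v w : E}
    (hvw : v ≠ w) (hs : s ∈ K.faces) (hst : (s : Set E) = {v, w}) (ht : t ∈ K.faces) (hts : t ≠ s) :
    convexHull ℝ (t : Set E) ∩ segment ℝ v w ⊆ {v, w} := by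
  classical
  rw [← convexHull_pair, ← hst]
  refine (K.inter_subset_convexHull ht hs).trans ?_
  have hs' : s = {v, w} := by
    rw [← Finset.coe_inj, hst, Finset.coe_pair]
  have hcard : s.card = 2 := by rw [hs', Finset.card_pair hvw]
  have hnot : ¬ (v ∈ t ∧ w ∈ t) := fun h => hts <| Eq.symm <|
    Finset.eq_of_subset_of_card_le (by rw [hs']; intro u; simp; rintro (rfl | rfl); exacts [h.1, h.2])
      ((hK t ht).trans hcard.ge)
  obtain h | h := not_and_or.1 hnot
  · have : (t ∩ s : Set E) ⊆ {w} := by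
      rw [hst]
      rintro u ⟨hu, rfl | rfl⟩
      exacts [absurd hu h, rfl]
    refine (convexHull_mono this).trans ?_
    rw [convexHull_singleton, singleton_subset_iff, hst]
    simp
  · have : (t ∩ s : Set E) ⊆ {v} := by
      rw [hst]
      rintro u ⟨hu, rfl | rfl⟩
      exacts [rfl, absurd hu h]
    refine (convexHull_mono this).trans ?_
    rw [convexHull_singleton, singleton_subset_iff, hst]
    simp

/-- The affine coordinate `θ` along the edge containing `p`, read modulo 1, sends both endpoints to
0, so it extends continuously by 0 over the other faces. -/
theorem exists_continuousOn_unitAddCircle (hfin : K.faces.Finite)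
    (hK : ∀ s ∈ K.faces, s.card ≤ 2) {p : E} (hp : p ∈ K.space) (hpv : p ∉ K.vertices) :
    ∃ φ : E → UnitAddCircle, ContinuousOn φ K.space ∧ φ p ≠ 0 ∧ InjOn φ {y | φ y ≠ 0} := by
  classical
  obtain ⟨v, w, hvw, ⟨s, hs, hst⟩, hpS, hpv, hpw⟩ := exists_edge_of_notMem_vertices hK hp hpv
  let θ : E → ℝ := fun y => inner ℝ (y - v) (w - v) / ‖w - v‖ ^ 2
  have hne : ‖w - v‖ ^ 2 ≠ 0 := by
    simpa [sub_eq_zero] using hvw.symm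
  have hθl : ∀ t : ℝ, θ (AffineMap.lineMap v w t) = t := fun t => by
    simp only [θ, AffineMap.lineMap_apply, vsub_eq_sub, vadd_eq_add, add_sub_cancel_right,
      real_inner_smul_left, real_inner_self_eq_norm_sq]
    exact mul_div_cancel_right₀ _ hne
  have hθS : ∀ y ∈ segment ℝ v w, θ y ∈ Icc (0 : ℝ) 1 ∧ y = AffineMap.lineMap v w (θ y) := by
    intro y hy
    rw [segment_eq_image_lineMap] at hy
    obtain ⟨t, ht, rfl⟩ := hy
    rw [hθl]
    exact ⟨ht, rfl⟩
  have hv0 : θ v = 0 := by simpa using hθl 0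
  have hw1 : θ w = 1 := by simpa using hθl 1
  have hθc : Continuous θ := by fun_prop
  let φ : E → UnitAddCircle := fun y => if y ∈ segment ℝ v w then (θ y : UnitAddCircle) else 0
  have hφ : ∀ y, φ y ≠ 0 → y = AffineMap.lineMap v w (θ y) ∧ θ y ∈ Ico (0 : ℝ) (0 + 1) ∧
      φ y = (θ y : UnitAddCircle) := by
    intro y hy
    have hyS : y ∈ segment ℝ v w := by
      by_contra h
      exact hy (if_neg h)
    have hφy : φ y = (θ y : UnitAddCircle) := if_pos hyS
    obtain ⟨⟨h0, h1⟩, h⟩ := hθS y hyS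
    refine ⟨h, ⟨h0, lt_of_le_of_ne (by simpa using h1) fun h1 => hy ?_⟩, hφy⟩
    rw [hφy, h1, zero_add]
    exact AddCircle.coe_period 1
  refine ⟨φ, ?_, ?_, ?_⟩
  · have hS : IsClosed (segment ℝ v w) := by
      rw [← convexHull_pair]
      exact (toFinite _).isClosed_convexHull ℝ
    have hC := isClosed_biUnion_convexHull (hfin.subset (sep_subset K.faces fun t => t ≠ s))
    have c1 : ContinuousOn φ (segment ℝ v w) :=
      ((AddCircle.continuous_mk' 1).comp hθc).continuousOn.congr fun y hy => if_pos hy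
    have c2 : ContinuousOn φ (⋃ t ∈ {t ∈ K.faces | t ≠ s}, convexHull ℝ (t : Set E)) := by
      refine (continuousOn_const (c := (0 : UnitAddCircle))).congr fun y hy => ?_
      obtain ⟨t, ⟨ht, hts⟩, hyt⟩ := mem_iUnion₂.1 hy
      by_cases hyS : y ∈ segment ℝ v w
      · have hφy : φ y = (θ y : UnitAddCircle) := if_pos hyS
        rw [hφy]
        obtain rfl | rfl := inter_segment_subset hK hvw hs hst ht hts ⟨hyt, hyS⟩
        · rw [hv0]; rfl
        · rw [hw1]; exact AddCircle.coe_period 1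
      · exact if_neg hyS
    refine (c1.union_of_isClosed c2 hS hC).mono fun y hy => ?_
    obtain ⟨t, ht, hyt⟩ := mem_space_iff.1 hy
    by_cases hts : t = s
    · left
      rwa [hts, hst, convexHull_pair] at hyt
    · right
      exact mem_biUnion (show t ∈ {t ∈ K.faces | t ≠ s} from ⟨ht, hts⟩) hyt
  · have hφp : φ p = (θ p : UnitAddCircle) := if_pos hpS
    obtain ⟨⟨h0, h1⟩, h⟩ := hθS p hpS
    rw [hφp]
    intro h'
    rw [← QuotientAddGroup.mk_zero, AddCircle.coe_eq_coe_iff_of_mem_Ico (a := 0) (p := 1)] at h'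
    · rw [h', AffineMap.lineMap_apply_zero] at h
      exact hpv h
    · refine ⟨h0, lt_of_le_of_ne (by simpa using h1) fun h1 => hpw ?_⟩
      rw [zero_add] at h1
      rw [h, h1, AffineMap.lineMap_apply_one]
    · simp
  · intro y hy z hz hyz
    obtain ⟨h1, h2, h3⟩ := hφ y hy
    obtain ⟨h1', h2', h3'⟩ := hφ z hz
    rw [h3, h3', AddCircle.coe_eq_coe_iff_of_mem_Ico h2 h2'] at hyz
    rw [h1, h1', hyz]

theorem finite_vertices (hK : K.faces.Finite) : K.vertices.Finite := by
  rw [vertices_eq]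
  exact hK.biUnion fun s _ => s.finite_toSet

end Geometry.SimplicialComplex

theorem IsMetricGraph.exists_continuous_unitAddCircle {X : Type*} [MetricSpace X]
    (hX : IsMetricGraph X) :
    ∃ V : Set X, V.Finite ∧ ∀ a ∉ V, ∃ φ : X → UnitAddCircle, Continuous φ ∧ φ a = 0 ∧
      ∃ U ∈ 𝓝 (0 : UnitAddCircle), InjOn φ (φ ⁻¹' U) := by
  obtain ⟨-, n, K, ⟨hfin, hcard, -⟩, ⟨e⟩⟩ := hX
  refine ⟨{x | (e x : EuclideanSpace ℝ (Fin n)) ∈ K.vertices},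
    (K.finite_vertices hfin).preimage (Subtype.val_injective.comp e.injective).injOn,
    fun a ha => ?_⟩
  obtain ⟨ψ, hc, ha0, hinj⟩ := K.exists_continuousOn_unitAddCircle hfin hcard (e a).2 ha
  refine ⟨fun x => ψ (e x) - ψ (e a), ?_, sub_self _, {u | u ≠ -ψ (e a)},
    isOpen_ne.mem_nhds (by simpa [eq_comm] using ha0), fun x hx y hy hxy => ?_⟩
  · exact ((continuousOn_iff_continuous_domRestrict.1 hc).comp e.continuous).sub continuous_const
  · have hx' : ψ (e x) ≠ 0 := fun h => hx (by simp [h])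
    have hy' : ψ (e y) ≠ 0 := fun h => hy (by simp [h])
    exact e.injective (Subtype.ext (hinj hx' hy' (sub_left_injective hxy)))

/-! ### Paths in a ball of radius half the minimal length -/

namespace Path

variable {X : Type*} [MetricSpace X]

theorem exists_two_mul_edist_add_lt {L : ℝ≥0∞} {a p q : X} (γ : Path p q)
    (hγ : ∀ t, 2 * edist a (γ t) < L) :
    ∃ η : NNReal, 0 < η ∧ ∀ s t, edist (γ s) (γ t) < η →
      edist a (γ s) + edist (γ s) (γ t) + edist a (γ t) < L := by
  obtain ⟨m, -, hm⟩ := isCompact_univ.exists_isMaxOn (univ_nonempty (α := I))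
    (f := fun t => edist a (γ t)) (Continuous.continuousOn (by fun_prop))
  obtain ⟨η, hη, h⟩ := ENNReal.lt_iff_exists_add_pos_lt.1 (hγ m)
  refine ⟨η, hη, fun s t hst => lt_of_le_of_lt ?_ h⟩
  calc _ ≤ edist a (γ m) + η + edist a (γ m) :=
        add_le_add (add_le_add (hm (mem_univ s)) hst.le) (hm (mem_univ t))
    _ = _ := by rw [two_mul]; abel

end Path

namespace IsMetricGraph

variable {X : Type*} [MetricSpace X] {L : ℝ≥0∞}

/-- Cut `γ` into short pieces. Each is homotopic to a geodesic in a small ball, and this geodesic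
forms with those from `a` to its ends a triangle of perimeter below `L`, hence a contractible one.
-/
theorem trans_homotopic_of_edist_lt (hX : IsMetricGraph X)
    (hL : ∀ (y : X) (δ : Path y y), δ.metricLength < L → δ.IsContractibleLoop)
    {a p q : X} (γ : Path p q) (hγ : ∀ t, 2 * edist a (γ t) < L) (c : Path a p) (d : Path a q)
    (hc : c.metricLength ≤ edist a p) (hd : d.metricLength ≤ edist a q) :
    (c.trans γ).Homotopic d := by
  obtain ⟨ε, hε, hsmall⟩ := hX.exists_ball_homotopic
  obtain ⟨η, hη, hLη⟩ := γ.exists_two_mul_edist_add_lt hγ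
  choose C hC using fun t => hX.1.exists_path a (γ t)
  obtain ⟨δ, hδ, hγδ⟩ := Metric.uniformContinuous_iff.1
    (CompactSpace.uniformContinuous_of_continuous γ.continuous) (min ε η)
    (lt_min hε (NNReal.coe_pos.2 hη))
  have step : ∀ s t, dist s t < δ →
      (Path.Homotopic.Quotient.mk (C s)).trans (.mk (γ.subpath s t)) = .mk (C t) := by
    intro s t hst
    obtain ⟨e, he, hed⟩ := hX.1.exists_path (γ s) (γ t)
    have hst' := hγδ hst
    have h1 : (γ.subpath s t).Homotopic e := by
      refine hsmall (γ s) _ _ _ _ (fun u => ?_) fun u => ?_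
      · have : γ.subpath s t u ∈ range (γ.subpath s t) := mem_range_self u
        rw [Path.range_subpath] at this
        obtain ⟨r, hr, hru⟩ := this
        rw [← hru, Metric.mem_ball]
        refine (hγδ (lt_of_le_of_lt ?_ hst)).trans_le (min_le_left _ _)
        rw [dist_comm r s, Subtype.dist_eq, Subtype.dist_eq]
        exact Real.dist_left_le_of_mem_uIcc (show (r : ℝ) ∈ uIcc (s : ℝ) t from hr)
      · rw [Metric.mem_ball, dist_comm]
        have := hed u
        have h0 : 0 ≤ dist (e u) (γ t) := dist_nonneg
        have := (lt_min_iff.1 hst').1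
        linarith
    have h2 : ((C s).trans e).Homotopic (C t) := by
      refine Path.homotopic_of_metricLength_add_lt hL _ _ (lt_of_le_of_lt ?_ (hLη s t ?_))
      · exact add_le_add ((Path.metricLength_trans_le _ _).trans (add_le_add (hC s).1 he)) (hC t).1
      · rw [edist_dist, ENNReal.ofReal_lt_coe_iff dist_nonneg]
        exact (lt_min_iff.1 hst').2
    rw [Path.Homotopic.Quotient.eq.2 h1, ← Path.Homotopic.Quotient.mk_trans]
    exact Path.Homotopic.Quotient.eq.2 h2
  -- By `step`, `S` and its complement contain the `δ`-ball around each of their points;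
  -- connectedness of `I` replaces induction along a subdivision.
  let S : Set I := {t | (Path.Homotopic.Quotient.mk (C 0)).trans (.mk (γ.subpath 0 t)) = .mk (C t)}
  have hS : ∀ s t, dist s t < δ → s ∈ S → t ∈ S := by
    intro s t hst hs
    have h : Path.Homotopic.Quotient.mk (γ.subpath 0 t) =
        (Path.Homotopic.Quotient.mk (γ.subpath 0 s)).trans (.mk (γ.subpath s t)) :=
      (Path.Homotopic.Quotient.eq.2 ⟨Path.Homotopy.subpathTransSubpath γ 0 s t⟩).symm
    change _ = _ at hs
    change _ = _
    rw [h, ← Path.Homotopic.Quotient.trans_assoc, hs, step s t hst]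
  have hclopen : IsClopen S := by
    constructor
    · rw [← isOpen_compl_iff, Metric.isOpen_iff]
      exact fun s hs => ⟨δ, hδ, fun t ht h => hs (hS t s ht h)⟩
    · rw [Metric.isOpen_iff]
      exact fun s hs => ⟨δ, hδ, fun t ht => hS s t (by rwa [dist_comm]) hs⟩
  have h0 : (0 : I) ∈ S := by
    change _ = _
    rw [Path.subpath_self]
    simp
  have h1 : (1 : I) ∈ S := (hclopen.eq_univ ⟨0, h0⟩).symm ▸ mem_univ _
  change _ = _ at h1
  -- The chosen geodesics `C 0`, `C 1` may differ from `c`, `d`, but each pair bounds a loop of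
  -- length below `L`.
  have hlt : ∀ (r : X) (t : I), r = γ t → ∀ g : Path a r, g.metricLength ≤ edist a r →
      ∀ h, (C t).Homotopic (g.cast rfl h) := by
    rintro r t rfl g hg h
    refine Path.homotopic_of_metricLength_add_lt hL _ _ (lt_of_le_of_lt ?_ (hγ t))
    rw [two_mul]
    exact add_le_add (hC t).1 hg
  rw [Path.Homotopic.Quotient.eq.2 (hlt p 0 γ.source.symm c hc γ.source),
    Path.Homotopic.Quotient.eq.2 (hlt q 1 γ.target.symm d hd γ.target), Path.subpath_zero_one,
    ← Path.Homotopic.Quotient.mk_trans] at h1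
  exact (Path.Homotopic.Quotient.eq.1 h1).pathCast rfl γ.target.symm

theorem homotopic_of_edist_lt (hX : IsMetricGraph X)
    (hL : ∀ (y : X) (δ : Path y y), δ.metricLength < L → δ.IsContractibleLoop)
    {a p q : X} (γ δ : Path p q) (hγ : ∀ t, 2 * edist a (γ t) < L)
    (hδ : ∀ t, 2 * edist a (δ t) < L) : γ.Homotopic δ := by
  obtain ⟨c, hc, -⟩ := hX.1.exists_path a p
  obtain ⟨d, hd, -⟩ := hX.1.exists_path a q
  have h := (hX.trans_homotopic_of_edist_lt hL γ hγ c d hc hd).trans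
    (hX.trans_homotopic_of_edist_lt hL δ hδ c d hc hd).symm
  rw [← Path.Homotopic.Quotient.eq] at h ⊢
  have := congrArg (fun Q => (Path.Homotopic.Quotient.mk c).symm.trans Q) h
  simpa [Path.Homotopic.Quotient.mk_trans, ← Path.Homotopic.Quotient.trans_assoc] using this

end IsMetricGraph

/-! ### The shortest loop is an isometric circle -/

namespace Path.IsShortestNoncontractibleLoop

variable {X : Type*} [MetricSpace X] {x : X} {α : Path x x}

theorem isContractibleLoop (hα : α.IsShortestNoncontractibleLoop) (y : X) (δ : Path y y)
    (h : δ.metricLength < α.metricLength) : δ.IsContractibleLoop := by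
  by_contra hδ
  exact h.not_ge (hα.2 y δ hδ)

/-- Were the length infinite, the bound on distances in `homotopic_of_edist_lt` would hold trivially
and contract `α`. -/
theorem metricLength_ne_top (hα : α.IsShortestNoncontractibleLoop) (hX : IsMetricGraph X) :
    α.metricLength ≠ ∞ := fun h => hα.1 <|
  hX.homotopic_of_edist_lt (a := x) hα.isContractibleLoop α (Path.refl x)
    (fun t => h ▸ ENNReal.mul_lt_top (by simp) (edist_lt_top _ _))
    fun t => h ▸ ENNReal.mul_lt_top (by simp) (edist_lt_top _ _)

theorem metricLength_ne_zero (hα : α.IsShortestNoncontractibleLoop) : α.metricLength ≠ 0 := by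
  intro h
  have hc : α = Path.refl x := by
    ext t
    have := (eVariationOn.eq_zero_iff α).1 h t (mem_univ t) 0 (mem_univ 0)
    rw [edist_eq_zero, α.source] at this
    exact this
  exact hα.1 (hc ▸ Path.Homotopic.refl _)

end Path.IsShortestNoncontractibleLoop

theorem AddCircle.dist_coe_coe_of_le {p a b : ℝ} (hp : 0 < p) (hab : a ≤ b) (hb : b - a ≤ p) :
    dist (a : AddCircle p) (b : AddCircle p) = min (b - a) (p - (b - a)) := by
  rw [dist_comm, dist_eq_norm, ← AddCircle.coe_sub]
  rcases le_total (b - a) (p / 2) with h | h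
  · rw [(AddCircle.norm_coe_eq_abs_iff p hp.ne').2, abs_of_nonneg (by linarith), min_eq_left]
    · linarith
    · rwa [abs_of_nonneg (by linarith), abs_of_pos hp]
  · rw [← norm_neg, ← AddCircle.coe_neg, ← AddCircle.coe_add_period p (-(b - a)),
      (AddCircle.norm_coe_eq_abs_iff p hp.ne').2, abs_of_nonneg (by linarith), min_eq_right]
    · ring
    · linarith
    · rw [abs_of_nonneg (by linarith), abs_of_pos hp]
      linarith

namespace BoundedVariationOn

variable {X : Type*} [MetricSpace X] {f : I → X}

theorem toReal_eVariationOn_Icc_sub (hf : BoundedVariationOn f univ) {s t : I} (hst : s ≤ t) :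
    (eVariationOn f (Icc 0 t)).toReal - (eVariationOn f (Icc 0 s)).toReal =
      (eVariationOn f (Icc s t)).toReal := by
  have h := eVariationOn.Icc_add_Icc f (s := univ) (unitInterval.nonneg' (t := s)) hst (mem_univ s)
  simp only [univ_inter] at h
  rw [← h, ENNReal.toReal_add (hf.mono (subset_univ _)) (hf.mono (subset_univ _))]
  ring

theorem continuous_toReal_eVariationOn_Icc (hf : BoundedVariationOn f univ) (hc : Continuous f) :
    Continuous fun t => (eVariationOn f (Icc 0 t)).toReal := by
  rw [continuous_iff_continuousAt]
  intro t
  have h1 := hf.tendsto_eVariationOn_Icc_zero_left (x := t) hc.continuousWithinAt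
  have h2 := hf.tendsto_eVariationOn_Icc_zero_right t hc.continuousWithinAt
  simp only [univ_inter, nhdsWithin_univ] at h1 h2
  have h := ((ENNReal.tendsto_toReal ENNReal.zero_ne_top).comp h1).add
    ((ENNReal.tendsto_toReal ENNReal.zero_ne_top).comp h2)
  rw [ContinuousAt, tendsto_iff_dist_tendsto_zero]
  refine squeeze_zero (fun _ => dist_nonneg) (fun s => ?_) (by simpa using h)
  have n1 : 0 ≤ (eVariationOn f (Icc s t)).toReal := ENNReal.toReal_nonneg
  have n2 : 0 ≤ (eVariationOn f (Icc t s)).toReal := ENNReal.toReal_nonneg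
  rcases le_total s t with hst | hst
  · rw [dist_comm, Real.dist_eq, hf.toReal_eVariationOn_Icc_sub hst, abs_of_nonneg n1]
    linarith
  · rw [Real.dist_eq, hf.toReal_eVariationOn_Icc_sub hst, abs_of_nonneg n2]
    linarith

end BoundedVariationOn

namespace Path.IsShortestNoncontractibleLoop

variable {X : Type*} [MetricSpace X] {x : X} {α : Path x x}

/-- Suppose a geodesic is shorter than both arcs. Being shorter than the complementary arc, it
closes up `α.subpath s t` to a contractible loop; being shorter than that subpath, it can replace it
to shorten `α` within its homotopy class. -/
theorem le_edist (hα : α.IsShortestNoncontractibleLoop) (hX : IsMetricGraph X) {s t : I}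
    (hst : s ≤ t) : min (eVariationOn α (Icc s t)) (α.metricLength - eVariationOn α (Icc s t)) ≤
      edist (α s) (α t) := by
  by_contra! h
  obtain ⟨h1, h2⟩ := lt_min_iff.1 h
  obtain ⟨c, hc, -⟩ := hX.1.exists_path (α s) (α t)
  have hsub : (α.subpath s t).Homotopic c := by
    refine homotopic_of_metricLength_add_lt hα.isContractibleLoop _ _ ?_
    refine (add_le_add (metricLength_subpath_le α hst) hc).trans_lt ?_
    rw [add_comm]
    exact lt_tsub_iff_right.1 h2
  have hL : eVariationOn α (Icc 0 s) + eVariationOn α (Icc s t) + eVariationOn α (Icc t 1) =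
      α.metricLength := by
    have e1 := eVariationOn.Icc_add_Icc α (s := univ) (unitInterval.nonneg' (t := s)) hst
      (mem_univ s)
    have e2 := eVariationOn.Icc_add_Icc α (s := univ) (unitInterval.nonneg' (t := t))
      (unitInterval.le_one' (t := t)) (mem_univ t)
    simp only [univ_inter] at e1 e2
    rw [e1, e2]
    congr 1
    ext u
    simpa using unitInterval.le_one'
  have htop := hα.metricLength_ne_top hX
  have f1 : eVariationOn α (Icc 0 s) ≠ ∞ := fun h => htop (by rw [← hL, h]; simp)
  have f3 : eVariationOn α (Icc t 1) ≠ ∞ := fun h => htop (by rw [← hL, h]; simp)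
  let δ := (α.subpath 0 s).trans (c.trans (α.subpath t 1))
  have hδ : δ.metricLength < α.metricLength := by
    calc δ.metricLength ≤ eVariationOn α (Icc 0 s) + (edist (α s) (α t) +
          eVariationOn α (Icc t 1)) :=
        (metricLength_trans_le _ _).trans (add_le_add
          (metricLength_subpath_le α unitInterval.nonneg')
          ((metricLength_trans_le _ _).trans (add_le_add hc
            (metricLength_subpath_le α unitInterval.le_one'))))
      _ < eVariationOn α (Icc 0 s) + (eVariationOn α (Icc s t) + eVariationOn α (Icc t 1)) :=
        ENNReal.add_lt_add_left f1 (ENNReal.add_lt_add_right f3 h1)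
      _ = α.metricLength := by rw [← hL, add_assoc]
  have hδα : (α.subpath 0 1).Homotopic δ :=
    calc (α.subpath 0 1).Homotopic ((α.subpath 0 s).trans (α.subpath s 1)) :=
          ⟨(Homotopy.subpathTransSubpath α 0 s 1).symm⟩
      Homotopic _ ((α.subpath 0 s).trans ((α.subpath s t).trans (α.subpath t 1))) :=
          (Homotopic.refl _).hcomp ⟨(Homotopy.subpathTransSubpath α s t 1).symm⟩
      Homotopic _ δ := (Homotopic.refl _).hcomp (hsub.hcomp (Homotopic.refl _))
  rw [subpath_zero_one] at hδα
  have hδα' := hδα.pathCast α.source.symm α.target.symm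
  exact hα.1 (Homotopic.trans hδα' (hα.isContractibleLoop x
    (δ.cast α.source.symm α.target.symm) hδ))

theorem exists_isometry (hα : α.IsShortestNoncontractibleLoop) (hX : IsMetricGraph X) :
    ∃ p : ℝ, 0 < p ∧ ENNReal.ofReal p = α.metricLength ∧
      ∃ g : AddCircle p → X, Isometry g ∧ range g = range α := by
  have htop := hα.metricLength_ne_top hX
  have hbv : BoundedVariationOn α univ := htop
  set p := α.metricLength.toReal with hp
  have hp0 : 0 < p := ENNReal.toReal_pos hα.metricLength_ne_zero htop
  let V : I → ℝ := fun t => (eVariationOn α (Icc 0 t)).toReal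
  have hV0 : V 0 = 0 := by
    simp [V, eVariationOn.subsingleton]
  have hV1 : V 1 = p := by
    have : (Icc 0 1 : Set I) = univ := by
      ext u
      simpa using unitInterval.le_one'
    simp only [V, this, hp]
    rfl
  have hVc : Continuous V := hbv.continuous_toReal_eVariationOn_Icc α.continuous
  have hVsub : ∀ s t : I, s ≤ t → V t - V s = (eVariationOn α (Icc s t)).toReal :=
    fun s t hst => hbv.toReal_eVariationOn_Icc_sub hst
  have hd : ∀ s t : I, s ≤ t → dist (α s) (α t) = dist (V s : AddCircle p) (V t) := by
    intro s t hst
    have hfin : eVariationOn α (Icc s t) ≠ ∞ := hbv.mono (subset_univ _)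
    have hle : eVariationOn α (Icc s t) ≤ α.metricLength := eVariationOn.mono _ (subset_univ _)
    have hVst : V s ≤ V t := sub_nonneg.1 (by rw [hVsub s t hst]; exact ENNReal.toReal_nonneg)
    have hVp : V t - V s ≤ p := by
      rw [hVsub s t hst]
      exact ENNReal.toReal_mono htop hle
    rw [AddCircle.dist_coe_coe_of_le hp0 hVst hVp]
    refine le_antisymm (le_min ?_ ?_) ?_
    · rw [hVsub s t hst, dist_edist]
      exact ENNReal.toReal_mono hfin (eVariationOn.edist_le _ ⟨le_rfl, hst⟩ ⟨hst, le_rfl⟩)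
    -- The complementary arc runs through the base point `x`.
    · have h1 : dist (α s) (α 0) ≤ V s := by
        rw [← sub_zero (V s), ← hV0, hVsub 0 s unitInterval.nonneg', dist_edist]
        exact ENNReal.toReal_mono (hbv.mono (subset_univ _)) (eVariationOn.edist_le _
          ⟨unitInterval.nonneg', le_rfl⟩ ⟨le_rfl, unitInterval.nonneg'⟩)
      have h2 : dist (α 1) (α t) ≤ p - V t := by
        rw [← hV1, hVsub t 1 unitInterval.le_one', dist_edist]
        exact ENNReal.toReal_mono (hbv.mono (subset_univ _)) (eVariationOn.edist_le _
          ⟨unitInterval.le_one', le_rfl⟩ ⟨le_rfl, unitInterval.le_one'⟩)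
      rw [α.source] at h1
      rw [α.target] at h2
      linarith [dist_triangle (α s) x (α t)]
    · have h := ENNReal.toReal_mono (edist_ne_top _ _) (hα.le_edist hX hst)
      rwa [← dist_edist, ENNReal.toReal_min hfin (ENNReal.sub_ne_top htop),
        ENNReal.toReal_sub_of_le hle htop, ← hVsub s t hst] at h
  have hd' : ∀ s t : I, dist (α s) (α t) = dist (V s : AddCircle p) (V t) := fun s t => by
    rcases le_total s t with h | h
    · exact hd s t h
    · rw [dist_comm, hd t s h, dist_comm]
  have hsurj : ∀ c : AddCircle p, ∃ t, (V t : AddCircle p) = c := by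
    have : Fact (0 < p) := ⟨hp0⟩
    intro c
    obtain ⟨b, hb, rfl⟩ := AddCircle.eq_coe_Ico c
    obtain ⟨t, -, ht⟩ := intermediate_value_Icc (zero_le_one (α := I)) hVc.continuousOn
      (show b ∈ Icc (V 0) (V 1) by rw [hV0, hV1]; exact Ico_subset_Icc_self hb)
    exact ⟨t, by rw [ht]⟩
  -- `T` need not be continuous: the distance formula `hd'` alone makes `α ∘ T` an isometry.
  choose T hT using hsurj
  refine ⟨p, hp0, ENNReal.ofReal_toReal htop, fun c => α (T c),
    Isometry.of_dist_eq fun c d => by rw [hd', hT, hT], ?_⟩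
  refine Subset.antisymm (range_subset_iff.2 fun c => mem_range_self _)
    (range_subset_iff.2 fun t => ⟨(V t : AddCircle p), ?_⟩)
  rw [← dist_eq_zero, hd', hT, dist_self]

end Path.IsShortestNoncontractibleLoop

/-! ### The centre separates the ball -/

theorem ContinuousOn.mul_pos_of_ne_zero {f : ℝ → ℝ} {a b : ℝ} (hf : ContinuousOn f (uIcc a b))
    (h0 : ∀ t ∈ uIcc a b, f t ≠ 0) : 0 < f a * f b := by
  by_contra! h
  have h0' : (0 : ℝ) ∈ uIcc (f a) (f b) := by
    rw [mem_uIcc]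
    rcases mul_nonpos_iff.1 h with h | h
    · exact Or.inr ⟨h.2, h.1⟩
    · exact Or.inl h
  obtain ⟨t, ht, ht0⟩ := intermediate_value_uIcc hf h0'
  exact h0 t ht ht0

theorem ContinuousOn.mul_neg_of_injOn {f : ℝ → ℝ} {δ : ℝ} (hδ : 0 < δ)
    (hf : ContinuousOn f (Ioo (-δ) δ)) (hi : InjOn f (Ioo (-δ) δ)) (h0 : f 0 = 0) :
    f (δ / 2) * f (-(δ / 2)) < 0 := by
  have m0 : (0 : ℝ) ∈ Ioo (-δ) δ := ⟨by linarith, hδ⟩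
  have m1 : δ / 2 ∈ Ioo (-δ) δ := ⟨by linarith, by linarith⟩
  have m2 : -(δ / 2) ∈ Ioo (-δ) δ := ⟨by linarith, by linarith⟩
  rcases hf.strictMonoOn_of_injOn_Ioo (by linarith) hi with h | h
  · have h1 := h m0 m1 (by linarith)
    have h2 := h m2 m0 (by linarith)
    rw [h0] at h1 h2
    exact mul_neg_of_pos_of_neg h1 h2
  · have h1 := h m0 m1 (by linarith)
    have h2 := h m2 m0 (by linarith)
    rw [h0] at h1 h2
    exact mul_neg_of_neg_of_pos h1 h2

section Separation

variable {X : Type*} [MetricSpace X] {G : ℝ → X} {r : ℝ}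

/-- Lift `φ` to `ℝ` along both paths. Along `G` the lift vanishes only at the centre and is
injective nearby, so it changes sign; along a path `β` avoiding the centre it never vanishes. The
paths are homotopic, so the lifts end at the same point, a contradiction. -/
theorem not_joinedIn_ball_diff_center (hc : Continuous G)
    (hG : ∀ s t, |s - t| ≤ r → dist (G s) (G t) = |s - t|)
    (hball : ∀ (x y : X) (γ δ : Path x y), (∀ u, γ u ∈ Metric.ball (G 0) r) →
      (∀ u, δ u ∈ Metric.ball (G 0) r) → γ.Homotopic δ)
    {φ : X → UnitAddCircle} (hφ : Continuous φ) (hφ0 : φ (G 0) = 0)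
    {U : Set UnitAddCircle} (hU : U ∈ 𝓝 0) (hinj : InjOn φ (φ ⁻¹' U))
    {s t : ℝ} (hs : s ∈ Ioo 0 r) (ht : t ∈ Ioo 0 r) :
    ¬ JoinedIn (Metric.ball (G 0) r \ {G 0}) (G t) (G (-s)) := by
  intro hJ
  obtain ⟨β, hβ⟩ := hJ
  have hr : 0 < r := hs.1.trans hs.2
  have hG0 : ∀ v, |v| ≤ r → dist (G v) (G 0) = |v| := fun v hv => by
    rw [hG v 0 (by simpa using hv), sub_zero]
  have hφz : ∀ y, y ≠ G 0 → φ y ≠ 0 := fun y hy h =>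
    hy (hinj (by rw [mem_preimage, h]; exact mem_of_mem_nhds hU)
      (by rw [mem_preimage, hφ0]; exact mem_of_mem_nhds hU) (h.trans hφ0.symm))
  have hcov := AddCircle.isCoveringMap_coe (1 : ℝ)
  obtain ⟨h, ⟨hh0, hhl⟩, -⟩ := hcov.existsUnique_continuousMap_lifts
    (⟨fun v => φ (G v), hφ.comp hc⟩ : C(ℝ, UnitAddCircle)) 0 0 hφ0.symm
  have hhl' : ∀ v, ((h v : ℝ) : UnitAddCircle) = φ (G v) := fun v => congrFun hhl v
  have hne : ∀ v, |v| < r → v ≠ 0 → h v ≠ 0 := fun v hv hv0 hhv => by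
    refine hφz (G v) (fun e => ?_) ?_
    · have := hG0 v hv.le
      rw [e, dist_self] at this
      exact hv0 (abs_eq_zero.1 this.symm)
    · rw [← hhl', hhv]
      rfl
  obtain ⟨δ, hδ, hδU⟩ := Metric.mem_nhds_iff.1
    ((hφ.comp hc).continuousAt.preimage_mem_nhds
      (show U ∈ 𝓝 ((φ ∘ G) 0) by rw [Function.comp, hφ0]; exact hU))
  -- The bound `δ` keeps `φ ∘ G` inside `U`; the bound `r / 2` keeps parameters within `r` of each
  -- other, where `G` preserves distances.
  let η := min δ (r / 2)
  have hη : 0 < η := lt_min hδ (by linarith)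
  have hηδ : η ≤ δ := min_le_left _ _
  have hηr : η ≤ r / 2 := min_le_right _ _
  have hinjh : InjOn h (Ioo (-η) η) := by
    intro v hv w hw hvw
    have hm : ∀ v ∈ Ioo (-η) η, G v ∈ φ ⁻¹' U := fun v hv => hδU (by
      rw [Metric.mem_ball, Real.dist_eq, sub_zero, abs_lt]
      exact ⟨by linarith [hv.1], by linarith [hv.2]⟩)
    have hGvw : G v = G w := hinj (hm v hv) (hm w hw) (by rw [← hhl', ← hhl', hvw])
    have := hG v w (by rw [abs_le]; constructor <;> linarith [hv.1, hv.2, hw.1, hw.2])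
    rw [hGvw, dist_self] at this
    exact sub_eq_zero.1 (abs_eq_zero.1 this.symm)
  have hC := ContinuousOn.mul_neg_of_injOn hη h.continuous.continuousOn hinjh hh0
  have hA : 0 < h t * h (η / 2) := by
    refine ContinuousOn.mul_pos_of_ne_zero h.continuous.continuousOn fun v hv => ?_
    have hv' : v ∈ Ioo 0 r := (convex_Ioo 0 r).ordConnected.uIcc_subset ht
      ⟨by linarith, by linarith⟩ hv
    exact hne v (by rw [abs_of_pos hv'.1]; exact hv'.2) hv'.1.ne'
  have hB : 0 < h (-s) * h (-(η / 2)) := by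
    refine ContinuousOn.mul_pos_of_ne_zero h.continuous.continuousOn fun v hv => ?_
    have hv' : v ∈ Ioo (-r) 0 := (convex_Ioo (-r) 0).ordConnected.uIcc_subset
      ⟨by linarith [hs.2], by linarith [hs.1]⟩ ⟨by linarith, by linarith⟩ hv
    exact hne v (by rw [abs_of_neg hv'.2]; linarith [hv'.1]) hv'.2.ne
  let γ : Path (G t) (G (-s)) :=
    { toFun := fun u => G (t + u * (-s - t))
      continuous_toFun := hc.comp (by fun_prop)
      source' := by simp
      target' := by simp }
  have hγ : ∀ u, γ u ∈ Metric.ball (G 0) r := fun u => by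
    have h1 : |t + (u : ℝ) * (-s - t)| < r := by
      have := u.2.1
      have := u.2.2
      rw [abs_lt]
      constructor <;> nlinarith [hs.1, hs.2, ht.1, ht.2]
    change G _ ∈ _
    rw [Metric.mem_ball, hG0 _ h1.le]
    exact h1
  have hhom : ((γ.map hφ).toContinuousMap).HomotopicRel (β.map hφ).toContinuousMap {0, 1} :=
    (hball _ _ γ β hγ fun u => (hβ u).1).map ⟨φ, hφ⟩
  have hγ0 : (γ.map hφ).toContinuousMap 0 = ((h t : ℝ) : UnitAddCircle) := by
    rw [hhl']; exact (γ.map hφ).source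
  have hβ0 : (β.map hφ).toContinuousMap 0 = ((h t : ℝ) : UnitAddCircle) := by
    rw [hhl']; exact (β.map hφ).source
  have hend := hcov.liftPath_apply_one_eq_of_homotopicRel hhom (h t) hγ0 hβ0
  have hΓ : (⟨fun u : I => h (t + u * (-s - t)), by fun_prop⟩ : C(I, ℝ)) =
      hcov.liftPath _ (h t) hγ0 := by
    rw [hcov.eq_liftPath_iff']
    refine ⟨funext fun u => hhl' _, ?_⟩
    change h _ = h t
    simp
  set b := hcov.liftPath _ (h t) hβ0 with hb
  have hb1 : b 1 = h (-s) := by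
    rw [← hend, ← hΓ]
    change h _ = _
    simp
  have hb0 : b 0 = h t := hcov.liftPath_zero _ _ _
  have hbl : ∀ u, ((b u : ℝ) : UnitAddCircle) = φ (β u) := fun u =>
    congrFun (hcov.liftPath_lifts _ (h t) hβ0) u
  have hD : 0 < h t * h (-s) := by
    have := ContinuousOn.mul_pos_of_ne_zero (f := fun v => b (projIcc 0 1 zero_le_one v))
      (a := 0) (b := 1) (b.continuous.comp continuous_projIcc).continuousOn fun v _ hv =>
        hφz _ (hβ (projIcc 0 1 zero_le_one v)).2 (by rw [← hbl, hv]; rfl)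
    rw [← hb1, ← hb0]
    simpa using this
  have := mul_pos hA hB
  have := mul_neg_of_pos_of_neg hD hC
  linarith

/-! ### Folding the graph onto the circle -/

open Classical in
/-- The map sending `x` to the point of the curve `G` at parameter `± min (dist (G 0) x) r`, with
the positive sign on the set `S`. -/
noncomputable def foldMap (G : ℝ → X) (r : ℝ) (S : Set X) (x : X) : X :=
  if x ∈ S then G (min (dist (G 0) x) r) else G (-min (dist (G 0) x) r)

/-- The points joined to the positive half of `G` inside the punctured ball. -/
def positiveSide (G : ℝ → X) (r : ℝ) : Set X :=
  {x | ∃ t ∈ Ioo 0 r, JoinedIn (Metric.ball (G 0) r \ {G 0}) (G t) x}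

theorem mem_positiveSide_trans {x y : X} (hx : x ∈ positiveSide G r)
    (h : JoinedIn (Metric.ball (G 0) r \ {G 0}) x y) : y ∈ positiveSide G r :=
  let ⟨t, ht, hJ⟩ := hx
  ⟨t, ht, hJ.trans h⟩

/-- A geodesic from `x` to `y` has a point `c u` outside the punctured ball. If it is the centre,
`dist x y` is the sum of the two radii; otherwise the images are joined through `G r = G (-r)`, and
reaching `c u` costs at least as much. -/
theorem dist_foldMap_le_of_mem_of_notMem (hX : IsGeodesicSpace X)
    (hG1 : ∀ s t, dist (G s) (G t) ≤ |s - t|) (hGr : G (-r) = G r) {x y : X}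
    (hx : x ∈ positiveSide G r) (hy : y ∉ positiveSide G r) :
    dist (foldMap G r (positiveSide G r) x) (foldMap G r (positiveSide G r) y) ≤ dist x y := by
  rw [foldMap, foldMap, if_pos hx, if_neg hy]
  obtain ⟨c, -, hc⟩ := hX.exists_path x y
  obtain ⟨u, hu⟩ : ∃ u, c u ∉ Metric.ball (G 0) r \ {G 0} := by
    by_contra! h
    exact hy (mem_positiveSide_trans hx ⟨c, h⟩)
  have hcu := hc u
  have t1 := dist_triangle (G 0) x (c u)
  have t2 := dist_triangle (G 0) y (c u)
  rw [dist_comm y (c u)] at t2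
  have mx := min_le_left (dist (G 0) x) r
  have my := min_le_left (dist (G 0) y) r
  by_cases h0 : c u = G 0
  · rw [h0, dist_comm x, dist_comm (G 0) y, dist_comm y] at hcu
    have d1 := hG1 (min (dist (G 0) x) r) (-min (dist (G 0) y) r)
    refine d1.trans ?_
    rcases le_total 0 r with hr | hr
    · rw [abs_of_nonneg (by
        have := le_min (dist_nonneg (x := G 0) (y := x)) hr
        have := le_min (dist_nonneg (x := G 0) (y := y)) hr
        linarith)]
      linarith
    -- For `r ≤ 0` the positive side is empty.
    · obtain ⟨t, ht, -⟩ := hx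
      linarith [ht.1, ht.2]
  · have hd : r ≤ dist (G 0) (c u) := by
      by_contra! h
      exact hu ⟨by rwa [Metric.mem_ball, dist_comm], h0⟩
    have d1 := hG1 (min (dist (G 0) x) r) r
    have d2 := hG1 (-r) (-min (dist (G 0) y) r)
    have ex : r - min (dist (G 0) x) r ≤ dist x (c u) := by
      rcases min_choice (dist (G 0) x) r with e | e <;> rw [e]
      · linarith
      · simp
    have ey : r - min (dist (G 0) y) r ≤ dist (c u) y := by
      rcases min_choice (dist (G 0) y) r with e | e <;> rw [e]
      · linarith
      · simp
    rw [abs_of_nonpos (by linarith [min_le_right (dist (G 0) x) r])] at d1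
    rw [abs_of_nonpos (by linarith [min_le_right (dist (G 0) y) r])] at d2
    rw [hGr] at d2
    linarith [dist_triangle (G (min (dist (G 0) x) r)) (G r) (G (-min (dist (G 0) y) r))]

theorem dist_foldMap_le (hX : IsGeodesicSpace X)
    (hG1 : ∀ s t, dist (G s) (G t) ≤ |s - t|) (hGr : G (-r) = G r) (x y : X) :
    dist (foldMap G r (positiveSide G r) x) (foldMap G r (positiveSide G r) y) ≤ dist x y := by
  have hmin : |min (dist (G 0) x) r - min (dist (G 0) y) r| ≤ dist x y := by
    refine (abs_min_sub_min_le_max _ _ _ _).trans (max_le ?_ (by simp))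
    rw [dist_comm (G 0) x, dist_comm (G 0) y]
    exact abs_dist_sub_le x y (G 0)
  by_cases hx : x ∈ positiveSide G r <;> by_cases hy : y ∈ positiveSide G r
  · rw [foldMap, foldMap, if_pos hx, if_pos hy]
    exact (hG1 _ _).trans hmin
  · exact dist_foldMap_le_of_mem_of_notMem hX hG1 hGr hx hy
  · rw [dist_comm, dist_comm x]
    exact dist_foldMap_le_of_mem_of_notMem hX hG1 hGr hy hx
  · rw [foldMap, foldMap, if_neg hx, if_neg hy]
    refine (hG1 _ _).trans ?_
    rwa [neg_sub_neg, abs_sub_comm]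

theorem foldMap_apply_curve (hr : 0 < r) (hG : ∀ s t, |s - t| ≤ r → dist (G s) (G t) = |s - t|)
    (hGr : G (-r) = G r) (hsep : ∀ s ∈ Ioo 0 r, G (-s) ∉ positiveSide G r) {v : ℝ}
    (hv : v ∈ Ioc (-r) r) : foldMap G r (positiveSide G r) (G v) = G v := by
  have hvr : |v| ≤ r := abs_le.2 ⟨hv.1.le, hv.2⟩
  have hd : min (dist (G 0) (G v)) r = |v| := by
    rw [hG 0 v (by simpa using hvr), zero_sub, abs_neg, min_eq_left hvr]
  rw [foldMap, hd]
  rcases lt_trichotomy v 0 with h | rfl | h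
  · rw [if_neg, abs_of_neg h, neg_neg]
    simpa using hsep (-v) ⟨by linarith, by linarith [hv.1]⟩
  · simp
  · rw [abs_of_pos h]
    rcases hv.2.lt_or_eq with h' | rfl
    · refine if_pos ⟨v, ⟨h, h'⟩, JoinedIn.refl ⟨?_, fun e => ?_⟩⟩
      · rw [Metric.mem_ball, hG v 0 (by simpa using hvr), sub_zero, abs_of_pos h]
        exact h'
      · have := hG v 0 (by simpa using hvr)
        rw [mem_singleton_iff.1 e, dist_self, sub_zero, abs_of_pos h] at this
        exact h.ne this
    -- At the antipode both branches agree, so its side is irrelevant.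
    · rw [hGr, ite_self]

end Separation

/-! ### Assembling the contraction -/

theorem mainTheorem5 {X : Type*} [MetricSpace X] (hX : IsMetricGraph X) {x : X} (α : Path x x)
    (hα : α.IsShortestNoncontractibleLoop) :
    ∃ f : X → Set.range α, IsContraction (Set.range α) f := by
  obtain ⟨p, hp, hpL, g, hg, hgα⟩ := hα.exists_isometry hX
  have : Fact (0 < p) := ⟨hp⟩
  obtain ⟨V, hV, hVφ⟩ := hX.exists_continuous_unitAddCircle
  -- The circle is infinite and `V` is finite.
  obtain ⟨c₀, hc₀⟩ : ∃ c, g c ∉ V := by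
    by_contra! h
    have hfin : Finite (AddCircle p) :=
      Set.finite_univ_iff.1 ((hV.preimage hg.injective.injOn).subset fun c _ => h c)
    have : Infinite (Ico (0 : ℝ) (0 + p)) := (Ico_infinite (by linarith)).to_subtype
    exact this.not_finite (Finite.of_equiv _ (AddCircle.equivIco p 0))
  obtain ⟨φ, hφ, hφ0, U, hU, hinj⟩ := hVφ _ hc₀
  let G : ℝ → X := fun v => g (c₀ + (v : AddCircle p))
  have hGd : ∀ s t, dist (G s) (G t) = ‖((s - t : ℝ) : AddCircle p)‖ := fun s t => by
    simp only [G]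
    rw [hg.dist_eq, dist_add_left, dist_eq_norm, AddCircle.coe_sub]
  have hG : ∀ s t, |s - t| ≤ p / 2 → dist (G s) (G t) = |s - t| := fun s t h => by
    rw [hGd, (AddCircle.norm_coe_eq_abs_iff p hp.ne').2 (by rwa [abs_of_pos hp])]
  have hG1 : ∀ s t, dist (G s) (G t) ≤ |s - t| := fun s t => by
    rcases le_total |s - t| (p / 2) with h | h
    · exact (hG s t h).le
    · rw [hGd]
      refine (AddCircle.norm_le_half_period p hp.ne').trans ?_
      rwa [abs_of_pos hp]
  have hGr : G (-(p / 2)) = G (p / 2) := by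
    have : ((-(p / 2) : ℝ) : AddCircle p) = ((p / 2 : ℝ) : AddCircle p) := by
      rw [← AddCircle.coe_add_period p (-(p / 2))]
      congr 1
      ring
    simp only [G, this]
  have hGc : Continuous G := hg.continuous.comp
    (continuous_const.add (AddCircle.continuous_mk' p))
  have hG0 : G 0 = g c₀ := by
    simp only [G]
    rw [AddCircle.coe_zero, add_zero]
  have hball : ∀ (x y : X) (γ δ : Path x y), (∀ u, γ u ∈ Metric.ball (G 0) (p / 2)) →
      (∀ u, δ u ∈ Metric.ball (G 0) (p / 2)) → γ.Homotopic δ := by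
    have key : ∀ y ∈ Metric.ball (G 0) (p / 2), 2 * edist (G 0) y < α.metricLength := by
      intro y hy
      rw [Metric.mem_ball, dist_comm] at hy
      rw [← hpL, edist_dist, ← ENNReal.ofReal_ofNat 2, ← ENNReal.ofReal_mul zero_le_two]
      exact (ENNReal.ofReal_lt_ofReal_iff hp).2 (by linarith)
    exact fun x y γ δ hγ hδ => hX.homotopic_of_edist_lt hα.isContractibleLoop γ δ
      (fun u => key _ (hγ u)) fun u => key _ (hδ u)
  have hsep : ∀ s ∈ Ioo 0 (p / 2), G (-s) ∉ positiveSide G (p / 2) := by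
    rintro s hs ⟨t, ht, hJ⟩
    exact not_joinedIn_ball_diff_center hGc hG hball hφ (hG0 ▸ hφ0) hU hinj hs ht hJ
  have hGα : ∀ v, G v ∈ range α := fun v => hgα ▸ mem_range_self _
  have hαG : ∀ y ∈ range α, ∃ v ∈ Ioc (-(p / 2)) (p / 2), G v = y := by
    intro y hy
    rw [← hgα] at hy
    obtain ⟨c, rfl⟩ := hy
    have hmem : c - c₀ ∈ ((↑) : ℝ → AddCircle p) '' Ioc (-(p / 2)) (-(p / 2) + p) := by
      rw [AddCircle.coe_image_Ioc_eq]
      trivial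
    obtain ⟨v, hv, hvc⟩ := hmem
    refine ⟨v, ⟨hv.1, by linarith [hv.2]⟩, ?_⟩
    simp only [G]
    rw [hvc, add_sub_cancel]
  let f : X → range α := fun y => ⟨foldMap G (p / 2) (positiveSide G (p / 2)) y, by
    unfold foldMap
    split_ifs
    · exact hGα _
    · exact hGα _⟩
  have hf : LipschitzWith 1 f := LipschitzWith.of_dist_le_mul fun y z => by
    rw [NNReal.coe_one, one_mul]
    exact dist_foldMap_le hX.1 hG1 hGr y z
  refine ⟨f, (isContraction_iff _ f).2 ⟨⟨(isCompact_range α.continuous).isClosed, hf.continuous,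
    fun a => Subtype.ext ?_⟩, hf⟩⟩
  obtain ⟨v, hv, hva⟩ := hαG a a.2
  change foldMap G (p / 2) (positiveSide G (p / 2)) a = a
  rw [← hva]
  exact foldMap_apply_curve (half_pos hp) hG hGr hsep hv
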